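/- Fidelity and sub-fidelity bounds for error mitigation. Fix a finite-dimensional quantum system with identity operator $\mathbb I$, integers $Q,K$, and quantum channels (completely positive trace-preserving maps) $\mathcal E_q^{(k)}$ on this system, $1\le q\le Q$, $1\le k\le K$. A $(Q,K)$-error mitigation protocol specifies, for every observable $A$ with $-\mathbb I/2\le A\le \mathbb I/2$, for each $k=1,\dots,K$ a POVM $\{M^{(k)}_{i}\}_i$ with finitely many outcomes on $Q$ copies of the system, and a real-valued estimator $e_A(i^{(1)},\dots,i^{(K)})$ (the POVMs may depend on $A$). For a state $\psi$ the outcomes $\mathbf i=(i^{(1)},\dots,i^{(K)})$ occur with probability $p_{\mathbf i}(\psi)=\prod_{k=1}^K \mathrm{Tr}\big[\mathcal E_1^{(k)}(\psi)\otimes\cdots\otimes\mathcal E_Q^{(k)}(\psi)\,M^{(k)}_{i^{(k)}}\big]$, the bias is $b_A(\psi)=\sum_{\mathbf i}p_{\mathbf i}(\psi)e_A(\mathbf i)-\mathrm{Tr}(A\psi)$, and $$b_{\max}=\sup_{A}\sup_{\psi}|b_A(\psi)|,\qquad \Delta e_{\max}=\sup_A\Big[\max_{\mathbf i}e_A(\mathbf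 i)-\min_{\mathbf i}e_A(\mathbf i)\Big]$$ in $[0,\infty]$, where $A$ ranges over all observables with $-\mathbb I/2\le A\le\mathbb I/2$ and $\psi$ over all (pure or mixed) states. Let $D_{\rm tr}(\rho,\sigma)=\frac12\|\rho-\sigma\|_1$, $F(\rho,\sigma)=\big(\mathrm{Tr}\sqrt{\sigma^{1/2}\rho\,\sigma^{1/2}}\big)^2$ and $E(\rho,\sigma)=\mathrm{Tr}(\rho\sigma)+\sqrt{2\left[(\mathrm{Tr}(\rho\sigma))^2-\mathrm{Tr}(\rho\sigma\rho\sigma)\right]}$. Then every $(Q,K)$-error mitigation protocol satisfies $$\Delta e_{\max}\ \ge\ \sup_{\psi,\phi}\frac{D_{\rm tr}(\psi,\phi)-2b_{\max}}{\sqrt{1-\prod_{q=1}^Q\prod_{k=1}^K F\big(\mathcal E_q^{(k)}(\psi),\mathcal E_q^{(k)}(\phi)\big)}}$$ and $$\Delta e_{\max}\ \ge\ \sup_{\psi,\phi}\frac{D_{\rm tr}(\psi,\phi)-2b_{\max}}{\sqrt{1-\prod_{q=1}^Q\prod_{k=1}^K E\big(\mathcal E_q^{(k)}(\psi),\mathcal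 E_q^{(k)}(\phi)\big)}},$$ where the quotient is read as $0$ at pairs $\psi,\phi$ for which the denominator vanishes; moreover, at every pair for which the denominator (of either bound) vanishes, the numerator is not positive: $D_{\rm tr}(\psi,\phi)\le 2b_{\max}$. -/

import Mathlib

open scoped MatrixOrder ComplexOrder ENNReal

noncomputable section

namespace ErrorMitigation

/-- Quantum states (density operators) of the system with orthonormal basis `ι`. -/
structure QState (ι : Type*) [Fintype ι] where
  mat : Matrix ι ι ℂ
  posSemidef : mat.PosSemidef
  trace_eq_one : mat.trace = 1

/-- `Φ` applied to the first factor of a matrix on the composite system `ι × α`, that is,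
`Φ ⊗ id_α`: the map `Φ` acts on each of the `ι × ι` blocks `(X ((·, a), (·, b)))`. -/
def ampliation {ι : Type*} (Φ : Matrix ι ι ℂ →ₗ[ℂ] Matrix ι ι ℂ) {α : Type*}
    (X : Matrix (ι × α) (ι × α) ℂ) : Matrix (ι × α) (ι × α) ℂ :=
  Matrix.of fun x y => Φ (Matrix.of fun i j => X (i, x.2) (j, y.2)) x.1 y.1

/-- Quantum channels: completely positive trace-preserving linear maps. -/
structure QChannel (ι : Type*) [Fintype ι] where
  toLinearMap : Matrix ι ι ℂ →ₗ[ℂ] Matrix ι ι ℂ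
  completelyPositive : ∀ (n : ℕ) (X : Matrix (ι × Fin n) (ι × Fin n) ℂ),
    X.PosSemidef → (ampliation toLinearMap X).PosSemidef
  tracePreserving : ∀ X : Matrix ι ι ℂ, (toLinearMap X).trace = X.trace

/-- A channel maps positive semidefinite matrices to positive semidefinite matrices. -/
theorem QChannel.map_posSemidef {ι : Type*} [Fintype ι] (Φ : QChannel ι) {X : Matrix ι ι ℂ}
    (hX : X.PosSemidef) : (Φ.toLinearMap X).PosSemidef := by
  have h := Φ.completelyPositive 1 (X.submatrix Prod.fst Prod.fst) (hX.submatrix _)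
  have h' := h.submatrix (fun i : ι => (i, (0 : Fin 1)))
  exact h'

/-- The output state `ℰ(ψ)` of a channel `ℰ` on the input state `ψ`. -/
def QChannel.apply {ι : Type*} [Fintype ι] (Φ : QChannel ι) (ψ : QState ι) : QState ι where
  mat := Φ.toLinearMap ψ.mat
  posSemidef := Φ.map_posSemidef ψ.posSemidef
  trace_eq_one := by rw [Φ.tracePreserving, ψ.trace_eq_one]

/-- A measurement (POVM) on the system `ι` with finite set of outcomes `Ω`. -/
structure POVM (ι : Type*) [DecidableEq ι] (Ω : Type*) [Fintype Ω] where
  effect : Ω → Matrix ι ι ℂ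
  posSemidef : ∀ i, (effect i).PosSemidef
  sum_eq_one : ∑ i, effect i = 1

/-- The tensor product `ρ₁ ⊗ ⋯ ⊗ ρ_Q` of `Q` matrices, in the product basis of the `Q`-fold
tensor power of the system `ι`. -/
def tensor {ι : Type*} {Q : ℕ} (ρ : Fin Q → Matrix ι ι ℂ) :
    Matrix (Fin Q → ι) (Fin Q → ι) ℂ :=
  Matrix.of fun x y => ∏ q, ρ q (x q) (y q)

/-- Observables `A` (Hermitian matrices) with `-I/2 ≤ A ≤ I/2` in the Loewner order. -/
structure BoundedObservable (ι : Type*) [DecidableEq ι] where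
  mat : Matrix ι ι ℂ
  lower : -((1 / 2 : ℂ) • (1 : Matrix ι ι ℂ)) ≤ mat
  upper : mat ≤ (1 / 2 : ℂ) • (1 : Matrix ι ι ℂ)

/-- A `(Q, K)`-error mitigation protocol: for every observable `A`, one POVM for each of the `K`
experiments, acting jointly on `Q` copies of the system, and a classical estimator `e_A` of the
`K` outcomes. Measurements and outcome sets may depend on `A`. -/
structure MitigationProtocol (ι : Type*) [DecidableEq ι] (Q K : ℕ) where
  numOutcomes : BoundedObservable ι → Fin K → ℕ
  povm : ∀ (A : BoundedObservable ι) (k : Fin K), POVM (Fin Q → ι) (Fin (numOutcomes A k))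
  estimator : ∀ A : BoundedObservable ι, (∀ k : Fin K, Fin (numOutcomes A k)) → ℝ

namespace MitigationProtocol

variable {ι : Type*} [Fintype ι] [DecidableEq ι] {Q K : ℕ}

/-- The probability of the outcomes `i = (i⁽¹⁾, …, i⁽ᴷ⁾)` on the ideal state `ψ`:
`∏ₖ Tr[(ℰ₁⁽ᵏ⁾(ψ) ⊗ ⋯ ⊗ ℰ_Q⁽ᵏ⁾(ψ)) M⁽ᵏ⁾_{i⁽ᵏ⁾}]`. -/
def prob (P : MitigationProtocol ι Q K) (E : Fin Q → Fin K → QChannel ι)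
    (A : BoundedObservable ι) (ψ : QState ι) (i : ∀ k : Fin K, Fin (P.numOutcomes A k)) : ℝ :=
  ∏ k, (tensor (fun q => ((E q k).apply ψ).mat) * (P.povm A k).effect (i k)).trace.re

/-- The bias `b_A(ψ) = ⟨E_A⟩ - Tr(A ψ)`. -/
def bias (P : MitigationProtocol ι Q K) (E : Fin Q → Fin K → QChannel ι)
    (A : BoundedObservable ι) (ψ : QState ι) : ℝ :=
  ∑ i, P.prob E A ψ i * P.estimator A i - (A.mat * ψ.mat).trace.re

/-- The maximum bias: the supremum of `|b_A(ψ)|` over all observables and states. -/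
def maxBias (P : MitigationProtocol ι Q K) (E : Fin Q → Fin K → QChannel ι) : ℝ≥0∞ :=
  ⨆ (A : BoundedObservable ι) (ψ : QState ι), ENNReal.ofReal |P.bias E A ψ|

/-- The spread `Δe_A = e_{A,max} - e_{A,min}` (over the finite set of outcome tuples). -/
def spread (P : MitigationProtocol ι Q K) (A : BoundedObservable ι) : ℝ :=
  (⨆ i, P.estimator A i) - ⨅ i, P.estimator A i

/-- The maximum spread: the supremum of `Δe_A` over all observables. -/
def maxSpread (P : MitigationProtocol ι Q K) : ℝ≥0∞ :=
  ⨆ A : BoundedObservable ι, ENNReal.ofReal (P.spread A)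

end MitigationProtocol

section

variable {ι : Type*} [Fintype ι] [DecidableEq ι]

/-- Trace distance `½ ‖ρ - σ‖₁`, with `‖X‖₁ = Tr √(X† X)`. -/
def traceDist (ρ σ : QState ι) : ℝ :=
  (1 / 2) * (CFC.sqrt ((ρ.mat - σ.mat).conjTranspose * (ρ.mat - σ.mat))).trace.re

/-- The (squared) fidelity `F(ρ, σ) = (Tr √(σ^{1/2} ρ σ^{1/2}))²`. -/
def fidelity (ρ σ : QState ι) : ℝ :=
  (CFC.sqrt (CFC.sqrt σ.mat * ρ.mat * CFC.sqrt σ.mat)).trace.re ^ 2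

/-- The sub-fidelity `E(ρ, σ) = Tr(ρσ) + √(2 [(Tr ρσ)² - Tr(ρσρσ)])`. -/
def subFidelity (ρ σ : QState ι) : ℝ :=
  (ρ.mat * σ.mat).trace.re +
    √(2 * ((ρ.mat * σ.mat).trace.re ^ 2 - (ρ.mat * σ.mat * ρ.mat * σ.mat).trace.re))

end

end ErrorMitigation

end

open ErrorMitigation

/-! Some observable `A` with `-I/2 ≤ A ≤ I/2` separates `ψ` from `φ` by exactly their trace distance
(Helstrom). Up to the two biases, the mean estimate for `A` must reproduce this gap. Means under two
outcome distributions differ by at most the spread times the total variation distance, which is at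
most `√(1 - B²)` for the Bhattacharyya overlap `B`.

It remains to bound `B` below by the product of root fidelities. By polar decomposition a root
fidelity is `Tr(U √ρ √σ)`; tensoring over copies, inserting the POVM and applying Cauchy–Schwarz
outcome by outcome gives `prod_rootFidelity_le`. Independent experiments multiply. The second bound
follows from `subFidelity_le_fidelity`. -/

namespace ErrorMitigation

open Matrix

/-! ### Polar decomposition and trace inequalities -/

section MatrixLemmas

variable {n : Type*} [Fintype n] [DecidableEq n]

/-- A Hermitian matrix has a Hermitian generalized inverse commuting with it. -/
theorem exists_hermitian_pseudoinverse {S : Matrix n n ℂ} (hS : S.IsHermitian) :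
    ∃ T : Matrix n n ℂ, Tᴴ = T ∧ T * S = S * T ∧ T * S * S = S ∧ T * S * T = T := by
  have hs : IsSelfAdjoint S := hS
  have hc (f : ℝ → ℝ) : ContinuousOn f (spectrum ℝ S) := (finite_real_spectrum).continuousOn f
  have hid : cfc (fun x : ℝ => x) S = S := cfc_id' ℝ S
  -- The convention `0⁻¹ = 0` makes this inverse vanish on the kernel of `S`.
  refine ⟨cfc (fun x : ℝ => x⁻¹) S, (cfc_predicate (p := IsSelfAdjoint) (fun x : ℝ => x⁻¹) S),
    ?_, ?_, ?_⟩
  · have h := (cfc_commute_cfc (fun x : ℝ => x⁻¹) (fun x : ℝ => x) S).eq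
    rwa [hid] at h
  · nth_rw 2 3 4 [← hid]
    rw [← cfc_mul _ _ S (hc _) (hc _), ← cfc_mul _ _ S (hc _) (hc _)]
    congr 1
    ext x
    by_cases hx : x = 0 <;> simp [hx]
  · nth_rw 2 [← hid]
    rw [← cfc_mul _ _ S (hc _) (hc _), ← cfc_mul _ _ S (hc _) (hc _)]
    congr 1
    ext x
    by_cases hx : x = 0 <;> simp [hx]

/-- Polar decomposition with a partial isometry: `U X = |X|` where `U† U` is a projection. -/
theorem exists_partialIsometry_mul_eq_sqrt (X : Matrix n n ℂ) :
    ∃ U : Matrix n n ℂ, U * X = CFC.sqrt (Xᴴ * X) ∧ (Uᴴ * U) * (Uᴴ * U) = Uᴴ * U := by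
  have hX : (0 : Matrix n n ℂ) ≤ Xᴴ * X := (posSemidef_conjTranspose_mul_self X).nonneg
  obtain ⟨T, hT, hc, h1, h2⟩ := exists_hermitian_pseudoinverse
    (nonneg_iff_posSemidef.mp (CFC.sqrt_nonneg (Xᴴ * X))).isHermitian
  have hSS := CFC.sqrt_mul_sqrt_self (Xᴴ * X) hX
  set S := CFC.sqrt (Xᴴ * X)
  -- `U = |X|⁺ X†`, so that `U X = |X|⁺ |X|² = |X|` even for singular `X`.
  refine ⟨T * Xᴴ, ?_, ?_⟩
  · rw [mul_assoc, ← hSS, ← mul_assoc, h1]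
  · rw [conjTranspose_mul, conjTranspose_conjTranspose, hT]
    calc X * T * (T * Xᴴ) * (X * T * (T * Xᴴ))
        = X * T * (T * (Xᴴ * X) * T) * (T * Xᴴ) := by simp only [mul_assoc]
      _ = X * T * (T * S * S) * T * T * Xᴴ := by rw [← hSS]; simp only [mul_assoc]
      _ = X * (T * S * T) * T * Xᴴ := by rw [h1]; simp only [mul_assoc]
      _ = X * T * (T * Xᴴ) := by rw [h2]; simp only [mul_assoc]

omit [DecidableEq n] in
theorem re_trace_conjTranspose_mul_self (A : Matrix n n ℂ) :
    (Aᴴ * A).trace.re = ∑ p : n × n, ‖A p.2 p.1‖ ^ 2 := by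
  simp only [trace, diag_apply, mul_apply, conjTranspose_apply, Complex.re_sum,
    Fintype.sum_prod_type]
  refine Finset.sum_congr rfl fun i _ => Finset.sum_congr rfl fun j _ => ?_
  rw [← Complex.normSq_eq_norm_sq, Complex.star_def, ← Complex.normSq_eq_conj_mul_self,
    Complex.ofReal_re]

omit [DecidableEq n] in
-- Cauchy–Schwarz for the Hilbert–Schmidt inner product.
theorem re_trace_mul_le_sqrt_mul_sqrt (A B : Matrix n n ℂ) :
    (A * B).trace.re ≤ √(Aᴴ * A).trace.re * √(Bᴴ * B).trace.re := by
  have hB : (Bᴴ * B).trace.re = ∑ p : n × n, ‖B p.1 p.2‖ ^ 2 := by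
    rw [re_trace_conjTranspose_mul_self, ← (Equiv.prodComm n n).sum_comp]
    rfl
  rw [re_trace_conjTranspose_mul_self, hB]
  refine le_trans ?_ (Real.sum_mul_le_sqrt_mul_sqrt Finset.univ _ _)
  simp only [trace, diag_apply, mul_apply, Complex.re_sum, Fintype.sum_prod_type]
  rw [Finset.sum_comm]
  refine Finset.sum_le_sum fun i _ => Finset.sum_le_sum fun j _ => ?_
  rw [← norm_mul]
  exact Complex.re_le_norm _

theorem re_trace_mul_nonneg {A B : Matrix n n ℂ} (hA : A.PosSemidef) (hB : B.PosSemidef) :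
    0 ≤ (A * B).trace.re := by
  have hBB := CFC.sqrt_mul_sqrt_self B hB.nonneg
  have hBh : (CFC.sqrt B)ᴴ = CFC.sqrt B :=
    (nonneg_iff_posSemidef.mp (CFC.sqrt_nonneg B)).isHermitian
  rw [← hBB, ← mul_assoc, trace_mul_comm, ← mul_assoc]
  have h := hA.conjTranspose_mul_mul_same (CFC.sqrt B)
  rw [hBh] at h
  exact (Complex.le_def.mp h.trace_nonneg).1

/-- For a partial isometry `U`, `|Tr U R S|` is bounded by the classical (Bhattacharyya) overlap of
the outcome distributions of `R† R` and `S S†` under any measurement. -/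
theorem re_trace_le_sum_sqrt_mul_sqrt {Ω : Type*} [Fintype Ω] (M : POVM n Ω)
    (R S : Matrix n n ℂ) {U : Matrix n n ℂ} (hU : (Uᴴ * U) * (Uᴴ * U) = Uᴴ * U) :
    (U * R * S).trace.re ≤
      ∑ i, √(Rᴴ * R * M.effect i).trace.re * √(S * Sᴴ * M.effect i).trace.re := by
  have hsum : (U * R * S).trace.re = ∑ i, (U * R * M.effect i * S).trace.re := by
    rw [← Complex.re_sum, ← trace_sum, ← Finset.sum_mul, ← Finset.mul_sum, M.sum_eq_one, mul_one]
  rw [hsum]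
  refine Finset.sum_le_sum fun i _ => ?_
  have hNN := CFC.sqrt_mul_sqrt_self (M.effect i) (M.posSemidef i).nonneg
  have hNh : (CFC.sqrt (M.effect i))ᴴ = CFC.sqrt (M.effect i) :=
    (nonneg_iff_posSemidef.mp (CFC.sqrt_nonneg (M.effect i))).isHermitian
  set N := CFC.sqrt (M.effect i)
  have hM := M.posSemidef i
  rw [← hNN] at hM ⊢
  -- The complement of a projection is a projection; hence `U† U ≤ 1`, and `U` can be dropped from
  -- the first Cauchy–Schwarz factor.
  have hproj : (1 - Uᴴ * U).PosSemidef := by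
    have h : (1 - Uᴴ * U) = (1 - Uᴴ * U)ᴴ * (1 - Uᴴ * U) := by
      simp only [conjTranspose_sub, conjTranspose_one, conjTranspose_mul,
        conjTranspose_conjTranspose, sub_mul, mul_sub, one_mul, mul_one, hU]
      abel
    rw [h]
    exact posSemidef_conjTranspose_mul_self _
  have hleft : ((U * R * N)ᴴ * (U * R * N)).trace.re ≤ (Rᴴ * R * (N * N)).trace.re := by
    have h := re_trace_mul_nonneg (hproj.conjTranspose_mul_mul_same R) hM
    have he : ((U * R * N)ᴴ * (U * R * N)).trace = (Rᴴ * (Uᴴ * U) * R * (N * N)).trace := by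
      rw [conjTranspose_mul, hNh, mul_assoc, trace_mul_comm]
      simp only [conjTranspose_mul, mul_assoc]
    rw [he]
    simp only [mul_sub, sub_mul, mul_one, trace_sub, Complex.sub_re] at h
    linarith
  have hright : ((N * S)ᴴ * (N * S)).trace.re = (S * Sᴴ * (N * N)).trace.re := by
    rw [conjTranspose_mul, hNh, mul_assoc, trace_mul_comm, trace_mul_comm (S * Sᴴ)]
    simp only [mul_assoc]
  calc (U * R * (N * N) * S).trace.re = (U * R * N * (N * S)).trace.re := by
        simp only [mul_assoc]
    _ ≤ _ := re_trace_mul_le_sqrt_mul_sqrt _ _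
    _ ≤ _ := by
      rw [hright]
      exact mul_le_mul_of_nonneg_right (Real.sqrt_le_sqrt hleft) (Real.sqrt_nonneg _)

end MatrixLemmas

end ErrorMitigation

namespace ErrorMitigation

open Matrix

/-! ### Tensor products -/

section Tensor

variable {ι : Type*} {Q : ℕ}

theorem tensor_conjTranspose (ρ : Fin Q → Matrix ι ι ℂ) :
    (tensor ρ)ᴴ = tensor fun q => (ρ q)ᴴ := by
  ext x y
  simp [tensor, conjTranspose_apply]

variable [Fintype ι]

theorem tensor_mul (ρ σ : Fin Q → Matrix ι ι ℂ) :
    tensor ρ * tensor σ = tensor fun q => ρ q * σ q := by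
  ext x y
  simp only [tensor, mul_apply, of_apply, ← Finset.prod_mul_distrib]
  rw [Finset.prod_univ_sum, Fintype.piFinset_univ]

theorem trace_tensor (ρ : Fin Q → Matrix ι ι ℂ) :
    (tensor ρ).trace = ∏ q, (ρ q).trace := by
  simp only [trace, diag_apply, tensor, of_apply]
  rw [Finset.prod_univ_sum, Fintype.piFinset_univ]

end Tensor

/-! ### Fidelity and sub-fidelity -/

section Fidelity

variable {ι : Type*} [Fintype ι] [DecidableEq ι] {Q : ℕ}

theorem QState.sqrt_conjTranspose (ρ : QState ι) : (CFC.sqrt ρ.mat)ᴴ = CFC.sqrt ρ.mat :=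
  (nonneg_iff_posSemidef.mp (CFC.sqrt_nonneg ρ.mat)).isHermitian

theorem QState.sqrt_mul_sqrt (ρ : QState ι) : CFC.sqrt ρ.mat * CFC.sqrt ρ.mat = ρ.mat :=
  CFC.sqrt_mul_sqrt_self ρ.mat ρ.posSemidef.nonneg

theorem tensor_posSemidef (ρ : Fin Q → QState ι) :
    (tensor fun q => (ρ q).mat).PosSemidef := by
  have h : tensor (fun q => (ρ q).mat) =
      (tensor fun q => CFC.sqrt (ρ q).mat)ᴴ * tensor fun q => CFC.sqrt (ρ q).mat := by
    simp only [tensor_conjTranspose, tensor_mul, QState.sqrt_conjTranspose, QState.sqrt_mul_sqrt]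
  rw [h]
  exact posSemidef_conjTranspose_mul_self _

/-- `√F(ρ, σ)`. -/
noncomputable def rootFidelity (ρ σ : QState ι) : ℝ :=
  (CFC.sqrt (CFC.sqrt σ.mat * ρ.mat * CFC.sqrt σ.mat)).trace.re

theorem rootFidelity_nonneg (ρ σ : QState ι) : 0 ≤ rootFidelity ρ σ :=
  (Complex.le_def.mp (nonneg_iff_posSemidef.mp (CFC.sqrt_nonneg _)).trace_nonneg).1

theorem fidelity_eq_rootFidelity_sq (ρ σ : QState ι) : fidelity ρ σ = rootFidelity ρ σ ^ 2 := rfl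

/-- The root fidelity of product states is bounded by the classical overlap of the outcome
distributions of any joint measurement. -/
theorem prod_rootFidelity_le {Ω : Type*} [Fintype Ω] (M : POVM (Fin Q → ι) Ω)
    (ρ σ : Fin Q → QState ι) :
    ∏ q, rootFidelity (ρ q) (σ q) ≤
      ∑ i, √(tensor (fun q => (ρ q).mat) * M.effect i).trace.re *
        √(tensor (fun q => (σ q).mat) * M.effect i).trace.re := by
  -- One partial isometry per copy: their tensor product is again one, and the trace factorizes, so
  -- multiplicativity of the fidelity is never needed.
  choose U hUX hU using fun q =>
    exists_partialIsometry_mul_eq_sqrt (CFC.sqrt (ρ q).mat * CFC.sqrt (σ q).mat)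
  have hproj : ((tensor U)ᴴ * tensor U) * ((tensor U)ᴴ * tensor U) = (tensor U)ᴴ * tensor U := by
    simp only [tensor_conjTranspose, tensor_mul, hU]
  have h := re_trace_le_sum_sqrt_mul_sqrt M (tensor fun q => CFC.sqrt (ρ q).mat)
    (tensor fun q => CFC.sqrt (σ q).mat) hproj
  simp only [tensor_conjTranspose, tensor_mul, QState.sqrt_conjTranspose,
    QState.sqrt_mul_sqrt] at h
  refine le_trans (le_of_eq ?_) h
  have htr (q : Fin Q) : (U q * CFC.sqrt (ρ q).mat * CFC.sqrt (σ q).mat).trace =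
      (rootFidelity (ρ q) (σ q) : ℂ) := by
    have he : (CFC.sqrt (ρ q).mat * CFC.sqrt (σ q).mat)ᴴ *
        (CFC.sqrt (ρ q).mat * CFC.sqrt (σ q).mat) =
        CFC.sqrt (σ q).mat * (ρ q).mat * CFC.sqrt (σ q).mat := by
      rw [conjTranspose_mul, QState.sqrt_conjTranspose, QState.sqrt_conjTranspose,
        mul_assoc, ← mul_assoc (CFC.sqrt (ρ q).mat) (CFC.sqrt (ρ q).mat),
        QState.sqrt_mul_sqrt, mul_assoc]
    rw [mul_assoc, hUX, he, rootFidelity]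
    refine Complex.ext rfl ?_
    exact (Complex.le_def.mp
      (nonneg_iff_posSemidef.mp (CFC.sqrt_nonneg _)).trace_nonneg).2.symm
  rw [trace_tensor]
  simp only [htr]
  rw [← Complex.ofReal_prod, Complex.ofReal_re]

/-- Twice the difference of squares on the left is `4 ∑_{i<j} x_i² x_j²`, while the right side is
`(2 ∑_{i<j} x_i x_j)²`, whose extra cross terms are nonnegative. The first conjunct drives the
induction and later permits taking the square root. -/
theorem two_mul_sum_sq_sub_le {α : Type*} (s : Finset α) {x : α → ℝ} (hx : ∀ i, 0 ≤ x i) :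
    ∑ i ∈ s, x i ^ 2 ≤ (∑ i ∈ s, x i) ^ 2 ∧
      2 * ((∑ i ∈ s, x i ^ 2) ^ 2 - ∑ i ∈ s, x i ^ 4) ≤
        ((∑ i ∈ s, x i) ^ 2 - ∑ i ∈ s, x i ^ 2) ^ 2 := by
  classical
  induction s using Finset.induction_on with
  | empty => simp
  | insert a s ha ih =>
    rw [Finset.sum_insert ha, Finset.sum_insert ha, Finset.sum_insert ha]
    have hp : 0 ≤ ∑ i ∈ s, x i := Finset.sum_nonneg fun i _ => hx i
    have hxa := hx a
    set p := ∑ i ∈ s, x i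
    set r := ∑ i ∈ s, x i ^ 2
    set t := ∑ i ∈ s, x i ^ 4
    obtain ⟨h1, h2⟩ := ih
    have h3 : 0 ≤ p * x a := mul_nonneg hp hxa
    have h4 : 0 ≤ (p ^ 2 - r) * (p * x a) := mul_nonneg (by linarith) h3
    have h5 : 0 ≤ (p ^ 2 - r) * x a ^ 2 := mul_nonneg (by linarith) (sq_nonneg _)
    constructor <;> nlinarith

theorem trace_pow_eq_sum_eigenvalues_pow {n : Type*} [Fintype n] [DecidableEq n]
    {S : Matrix n n ℂ} (hS : S.IsHermitian) (k : ℕ) :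
    (S ^ k).trace = ∑ i, (hS.eigenvalues i : ℂ) ^ k := by
  conv_lhs => rw [hS.spectral_theorem, ← map_pow, Unitary.conjStarAlgAut_apply,
    trace_mul_cycle, Unitary.coe_star_mul_self, one_mul, diagonal_pow, trace_diagonal]
  simp

theorem subFidelity_nonneg (ρ σ : QState ι) : 0 ≤ subFidelity ρ σ :=
  add_nonneg (re_trace_mul_nonneg ρ.posSemidef σ.posSemidef) (Real.sqrt_nonneg _)

/-- With `S = √(√σ ρ √σ)`, cyclicity gives `Tr ρσ = Tr S²` and `Tr ρσρσ = Tr S⁴`, while `F = (Tr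
S)²`. This leaves an inequality between power sums of the eigenvalues of `S`. -/
theorem subFidelity_le_fidelity (ρ σ : QState ι) : subFidelity ρ σ ≤ fidelity ρ σ := by
  have hM : (0 : Matrix ι ι ℂ) ≤ CFC.sqrt σ.mat * ρ.mat * CFC.sqrt σ.mat := by
    have h := ρ.posSemidef.conjTranspose_mul_mul_same (CFC.sqrt σ.mat)
    rw [σ.sqrt_conjTranspose] at h
    exact h.nonneg
  have hSS := CFC.sqrt_mul_sqrt_self _ hM
  have hS := nonneg_iff_posSemidef.mp
    (CFC.sqrt_nonneg (CFC.sqrt σ.mat * ρ.mat * CFC.sqrt σ.mat))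
  rw [fidelity]
  set S := CFC.sqrt (CFC.sqrt σ.mat * ρ.mat * CFC.sqrt σ.mat)
  have hR := σ.sqrt_mul_sqrt
  set R := CFC.sqrt σ.mat
  have h2 : (ρ.mat * σ.mat).trace = (S ^ 2).trace := by
    rw [pow_two, hSS, ← hR, ← mul_assoc, trace_mul_comm, mul_assoc]
  have h4 : (ρ.mat * σ.mat * ρ.mat * σ.mat).trace = (S ^ 4).trace := by
    rw [show S ^ 4 = (S * S) * (S * S) by simp only [pow_succ, pow_zero, one_mul, mul_assoc],
      hSS, ← hR, ← mul_assoc (ρ.mat * (R * R) * ρ.mat), trace_mul_comm]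
    simp only [mul_assoc]
  have hp (k : ℕ) : (S ^ k).trace.re = ∑ i, hS.1.eigenvalues i ^ k := by
    rw [trace_pow_eq_sum_eigenvalues_pow hS.1, Complex.re_sum]
    simp only [← Complex.ofReal_pow, Complex.ofReal_re]
  have h1 := hp 1
  simp only [pow_one] at h1
  rw [subFidelity, h2, h4, hp, hp, h1]
  obtain ⟨ha, hb⟩ := two_mul_sum_sq_sub_le Finset.univ hS.eigenvalues_nonneg
  have h := Real.sqrt_le_iff.mpr ⟨sub_nonneg.mpr ha, hb⟩
  linarith

end Fidelity

end ErrorMitigation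

namespace ErrorMitigation

open Matrix

/-! ### Classical distributions -/

section Classical

variable {α : Type*} [Fintype α]

/-- The total variation distance of two distributions is bounded by their Bhattacharyya overlap. -/
theorem sum_abs_sub_le_two_mul_sqrt {p q : α → ℝ} (hp : ∀ i, 0 ≤ p i) (hq : ∀ i, 0 ≤ q i)
    (hp1 : ∑ i, p i = 1) (hq1 : ∑ i, q i = 1) :
    ∑ i, |p i - q i| ≤ 2 * √(1 - (∑ i, √(p i) * √(q i)) ^ 2) := by
  have hmul (i : α) : |p i - q i| = |√(p i) - √(q i)| * (√(p i) + √(q i)) := by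
    have h : p i - q i = (√(p i) - √(q i)) * (√(p i) + √(q i)) := by
      nlinarith [Real.sq_sqrt (hp i), Real.sq_sqrt (hq i)]
    rw [h, abs_mul, abs_of_nonneg (a := √(p i) + √(q i)) (by positivity)]
  have hsub : ∑ i, |√(p i) - √(q i)| ^ 2 = 2 - 2 * ∑ i, √(p i) * √(q i) := by
    have h (i : α) : |√(p i) - √(q i)| ^ 2 = p i + q i - 2 * (√(p i) * √(q i)) := by
      rw [sq_abs]
      linear_combination Real.sq_sqrt (hp i) + Real.sq_sqrt (hq i)
    simp only [h]
    rw [Finset.sum_sub_distrib, Finset.sum_add_distrib, ← Finset.mul_sum, hp1, hq1]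
    norm_num
  have hadd : ∑ i, (√(p i) + √(q i)) ^ 2 = 2 + 2 * ∑ i, √(p i) * √(q i) := by
    have h (i : α) : (√(p i) + √(q i)) ^ 2 = p i + q i + 2 * (√(p i) * √(q i)) := by
      linear_combination Real.sq_sqrt (hp i) + Real.sq_sqrt (hq i)
    simp only [h]
    rw [Finset.sum_add_distrib, Finset.sum_add_distrib, ← Finset.mul_sum, hp1, hq1]
    norm_num
  -- Cauchy–Schwarz on `|√p - √q| (√p + √q)`; the squared sums are `2 - 2B` and `2 + 2B`, with
  -- product `4 (1 - B²)`.
  have h := Real.sum_mul_le_sqrt_mul_sqrt Finset.univ (fun i => |√(p i) - √(q i)|)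
    (fun i => √(p i) + √(q i))
  have h0 : 0 ≤ 2 - 2 * ∑ i, √(p i) * √(q i) :=
    hsub ▸ Finset.sum_nonneg fun i _ => sq_nonneg _
  rw [hsub, hadd, ← Real.sqrt_mul h0] at h
  simp only [hmul]
  refine h.trans (le_of_eq ?_)
  rw [show (2 - 2 * ∑ i, √(p i) * √(q i)) * (2 + 2 * ∑ i, √(p i) * √(q i)) =
    2 ^ 2 * (1 - (∑ i, √(p i) * √(q i)) ^ 2) by ring, Real.sqrt_mul (by norm_num),
    Real.sqrt_sq (by norm_num)]

/-- Expectations under two distributions differ by at most the spread times the total variation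
distance. -/
theorem sum_mul_sub_sum_mul_le {p q e : α → ℝ} (hp1 : ∑ i, p i = 1) (hq1 : ∑ i, q i = 1) :
    ∑ i, p i * e i - ∑ i, q i * e i ≤ ((⨆ i, e i) - ⨅ i, e i) * ((∑ i, |p i - q i|) / 2) := by
  have hup (i : α) : e i ≤ ⨆ i, e i := le_ciSup (Set.finite_range e).bddAbove i
  have hlo (i : α) : ⨅ i, e i ≤ e i := ciInf_le (Set.finite_range e).bddBelow i
  set b := ⨆ i, e i
  set a := ⨅ i, e i
  -- Equal total masses allow centring `e` at its midrange, which yields the factor `1/2`.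
  have h0 : ∑ i, (p i - q i) * ((a + b) / 2) = 0 := by
    rw [← Finset.sum_mul, Finset.sum_sub_distrib, hp1, hq1, sub_self, zero_mul]
  have h1 : ∑ i, p i * e i - ∑ i, q i * e i = ∑ i, (p i - q i) * (e i - (a + b) / 2) := by
    simp only [mul_sub]
    rw [Finset.sum_sub_distrib, h0, sub_zero, ← Finset.sum_sub_distrib]
    simp only [sub_mul]
  rw [h1, mul_div_assoc', Finset.mul_sum, Finset.sum_div]
  refine Finset.sum_le_sum fun i _ => (le_abs_self _).trans ?_
  have h2 : |e i - (a + b) / 2| ≤ (b - a) / 2 :=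
    abs_le.mpr ⟨by linarith [hlo i], by linarith [hup i]⟩
  rw [abs_mul]
  nlinarith [mul_le_mul_of_nonneg_left h2 (abs_nonneg (p i - q i))]

theorem iInf_le_iSup_of_finite [Nonempty α] (e : α → ℝ) : ⨅ i, e i ≤ ⨆ i, e i :=
  (ciInf_le (Set.finite_range e).bddBelow (Classical.arbitrary α)).trans
    (le_ciSup (Set.finite_range e).bddAbove _)

end Classical

/-! ### The optimal distinguishing observable -/

section Helstrom

variable {ι : Type*} [Fintype ι] [DecidableEq ι]

/-- The trace distance is attained by an observable with `-I/2 ≤ A ≤ I/2`. -/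
theorem exists_observable_eq_traceDist (ψ φ : QState ι) :
    ∃ A : BoundedObservable ι,
      (A.mat * ψ.mat).trace.re - (A.mat * φ.mat).trace.re = traceDist ψ φ := by
  set D := ψ.mat - φ.mat with hD
  have hDh : D.IsHermitian := ψ.posSemidef.isHermitian.sub φ.posSemidef.isHermitian
  have hs : IsSelfAdjoint D := hDh
  have hc (f : ℝ → ℝ) : ContinuousOn f (spectrum ℝ D) := (finite_real_spectrum).continuousOn f
  have hsc : algebraMap ℝ (Matrix ι ι ℂ) (1 / 2) = (1 / 2 : ℂ) • (1 : Matrix ι ι ℂ) := by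
    rw [Algebra.algebraMap_eq_smul_one, ← Complex.coe_smul]
    norm_num
  have hle (x : ℝ) : |(1 / 2) * (SignType.sign x : ℝ)| ≤ 1 / 2 := by
    rcases lt_trichotomy x 0 with h | h | h <;> simp [h, abs_of_pos]
  -- Half the sign of `D = ψ - φ`: then `x f(x) = |x| / 2`.
  let f : ℝ → ℝ := fun x => (1 / 2) * (SignType.sign x : ℝ)
  refine ⟨⟨cfc f D, ?_, ?_⟩, ?_⟩
  · rw [← hsc, ← map_neg]
    exact algebraMap_le_cfc f _ D (fun x _ => (abs_le.mp (hle x)).1) (hc f)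
  · rw [← hsc]
    exact cfc_le_algebraMap f _ D (fun x _ => (abs_le.mp (hle x)).2) (hc f)
  · have habs : CFC.sqrt (Dᴴ * D) = cfc (fun x : ℝ => ‖x‖) D := CFC.abs_eq_cfc_norm D
    rw [traceDist, ← hD, habs, ← Complex.sub_re, ← trace_sub]
    change (cfc f D * ψ.mat - cfc f D * φ.mat).trace.re = _
    rw [← mul_sub, ← hD]
    have hmul : cfc f D * D = (1 / 2 : ℝ) • cfc (fun x : ℝ => ‖x‖) D := by
      nth_rw 2 [← cfc_id' ℝ D]
      rw [← cfc_mul f _ D (hc _) (hc _), ← cfc_smul _ _ D (hc _)]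
      congr 1
      ext x
      simp only [f, mul_assoc, sign_mul_self, Real.norm_eq_abs, smul_eq_mul]
    rw [hmul, trace_smul, Complex.smul_re, smul_eq_mul]

end Helstrom

/-! ### Bounds for a protocol -/

namespace MitigationProtocol

variable {ι : Type*} [Fintype ι] [DecidableEq ι] {Q K : ℕ}
  (P : MitigationProtocol ι Q K) (E : Fin Q → Fin K → QChannel ι) (A : BoundedObservable ι)

/-- The outcome probability of the `k`-th experiment. -/
noncomputable def experimentProb (ψ : QState ι) (k : Fin K) (j : Fin (P.numOutcomes A k)) : ℝ :=
  (tensor (fun q => ((E q k).apply ψ).mat) * (P.povm A k).effect j).trace.re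

theorem experimentProb_nonneg (ψ : QState ι) (k : Fin K) (j : Fin (P.numOutcomes A k)) :
    0 ≤ P.experimentProb E A ψ k j :=
  re_trace_mul_nonneg (tensor_posSemidef _) ((P.povm A k).posSemidef j)

theorem sum_experimentProb (ψ : QState ι) (k : Fin K) :
    ∑ j, P.experimentProb E A ψ k j = 1 := by
  simp only [experimentProb]
  rw [← Complex.re_sum, ← trace_sum, ← Finset.mul_sum, (P.povm A k).sum_eq_one, mul_one,
    trace_tensor]
  simp [QState.trace_eq_one]

theorem prob_eq_prod (ψ : QState ι) (i : ∀ k : Fin K, Fin (P.numOutcomes A k)) :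
    P.prob E A ψ i = ∏ k, P.experimentProb E A ψ k (i k) := rfl

theorem prob_nonneg (ψ : QState ι) (i : ∀ k : Fin K, Fin (P.numOutcomes A k)) :
    0 ≤ P.prob E A ψ i :=
  Finset.prod_nonneg fun _ _ => P.experimentProb_nonneg E A ψ _ _

theorem sum_prob (ψ : QState ι) : ∑ i, P.prob E A ψ i = 1 := by
  simp only [prob_eq_prod]
  rw [← Fintype.prod_sum]
  simp [sum_experimentProb]

theorem prod_rootFidelity_le_overlap (ψ φ : QState ι) :
    ∏ k, ∏ q, rootFidelity ((E q k).apply ψ) ((E q k).apply φ) ≤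
      ∑ i, √(P.prob E A ψ i) * √(P.prob E A φ i) := by
  have h (i : ∀ k : Fin K, Fin (P.numOutcomes A k)) : √(P.prob E A ψ i) * √(P.prob E A φ i) =
      ∏ k, √(P.experimentProb E A ψ k (i k)) * √(P.experimentProb E A φ k (i k)) := by
    rw [prob_eq_prod, prob_eq_prod, Finset.prod_mul_distrib,
      Real.sqrt_prod _ fun _ _ => P.experimentProb_nonneg E A _ _ _,
      Real.sqrt_prod _ fun _ _ => P.experimentProb_nonneg E A _ _ _]
  simp only [h]
  rw [← Fintype.prod_sum (f := fun k j =>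
    √(P.experimentProb E A ψ k j) * √(P.experimentProb E A φ k j))]
  exact Finset.prod_le_prod
    (fun k _ => Finset.prod_nonneg fun q _ => rootFidelity_nonneg _ _)
    (fun k _ => prod_rootFidelity_le (P.povm A k) _ _)

/-- The state ensures that outcome tuples exist: probabilities over an empty set could not sum to
`1`. -/
theorem spread_nonneg (ψ : QState ι) (E : Fin Q → Fin K → QChannel ι) : 0 ≤ P.spread A := by
  have : Nonempty (∀ k : Fin K, Fin (P.numOutcomes A k)) := by
    by_contra h
    rw [not_nonempty_iff] at h
    simpa using P.sum_prob E A ψ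
  exact sub_nonneg.mpr (iInf_le_iSup_of_finite _)

/-- Any lower bound `g` on the fidelity product is allowed, so that fidelity and sub-fidelity are
handled together. -/
theorem exists_traceDist_le (ψ φ : QState ι) {g : ℝ}
    (hg : g ≤ ∏ q, ∏ k, fidelity ((E q k).apply ψ) ((E q k).apply φ)) :
    ∃ A : BoundedObservable ι,
      traceDist ψ φ ≤ |P.bias E A ψ| + |P.bias E A φ| + P.spread A * √(1 - g) := by
  obtain ⟨A, hA⟩ := exists_observable_eq_traceDist ψ φ
  refine ⟨A, ?_⟩
  have hsum := sum_mul_sub_sum_mul_le (e := P.estimator A) (P.sum_prob E A ψ) (P.sum_prob E A φ)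
  have htv := sum_abs_sub_le_two_mul_sqrt (P.prob_nonneg E A ψ) (P.prob_nonneg E A φ)
    (P.sum_prob E A ψ) (P.sum_prob E A φ)
  have hfid : g ≤ (∑ i, √(P.prob E A ψ i) * √(P.prob E A φ i)) ^ 2 := by
    refine hg.trans ?_
    simp only [fidelity_eq_rootFidelity_sq, Finset.prod_pow]
    rw [Finset.prod_comm]
    exact pow_le_pow_left₀ (Finset.prod_nonneg fun k _ => Finset.prod_nonneg fun q _ =>
      rootFidelity_nonneg _ _) (P.prod_rootFidelity_le_overlap E A ψ φ) 2
  have hsqrt : √(1 - (∑ i, √(P.prob E A ψ i) * √(P.prob E A φ i)) ^ 2) ≤ √(1 - g) :=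
    Real.sqrt_le_sqrt (by linarith)
  have hspread : ((⨆ i, P.estimator A i) - ⨅ i, P.estimator A i) *
      ((∑ i, |P.prob E A ψ i - P.prob E A φ i|) / 2) ≤ P.spread A * √(1 - g) :=
    mul_le_mul_of_nonneg_left (by linarith) (P.spread_nonneg A ψ E)
  have h1 := neg_abs_le (P.bias E A ψ)
  have h2 := le_abs_self (P.bias E A φ)
  simp only [bias] at h1 h2 ⊢
  linarith

theorem quotient_le_maxSpread (ψ φ : QState ι) {g : ℝ}
    (hg : g ≤ ∏ q, ∏ k, fidelity ((E q k).apply ψ) ((E q k).apply φ)) :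
    ((traceDist ψ φ : EReal) - 2 * (P.maxBias E : EReal)) / ((√(1 - g) : ℝ) : EReal) ≤
        (P.maxSpread : EReal) ∧
      (√(1 - g) = 0 → (traceDist ψ φ : EReal) ≤ 2 * (P.maxBias E : EReal)) := by
  obtain ⟨A, hA⟩ := P.exists_traceDist_le E ψ φ hg
  have hbias (χ : QState ι) : ((|P.bias E A χ| : ℝ) : EReal) ≤ (P.maxBias E : EReal) := by
    have h : ENNReal.ofReal |P.bias E A χ| ≤ P.maxBias E :=
      le_iSup₂ (f := fun A χ => ENNReal.ofReal |P.bias E A χ|) A χ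
    have h' := EReal.coe_ennreal_le_coe_ennreal_iff.mpr h
    rwa [EReal.coe_ennreal_ofReal, max_eq_left (abs_nonneg _)] at h'
  have hspread : ((P.spread A : ℝ) : EReal) ≤ (P.maxSpread : EReal) := by
    have h : ENNReal.ofReal (P.spread A) ≤ P.maxSpread :=
      le_iSup (f := fun A => ENNReal.ofReal (P.spread A)) A
    have h' := EReal.coe_ennreal_le_coe_ennreal_iff.mpr h
    rwa [EReal.coe_ennreal_ofReal, max_eq_left (P.spread_nonneg A ψ E)] at h'
  -- This form avoids subtraction, so it survives an infinite `maxBias`, and at zero denominator it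
  -- is already the second claim.
  have hbound : (traceDist ψ φ : EReal) ≤
      ((P.spread A * √(1 - g) : ℝ) : EReal) + 2 * (P.maxBias E : EReal) := by
    have h := EReal.coe_le_coe_iff.mpr hA
    rw [EReal.coe_add, EReal.coe_add, add_comm] at h
    refine h.trans (add_le_add le_rfl ?_)
    have htwo : 2 * (P.maxBias E : EReal) = P.maxBias E + P.maxBias E := by
      rw [← EReal.coe_ennreal_add, ← two_mul, EReal.coe_ennreal_mul]
      rfl
    rw [htwo]
    exact add_le_add (hbias ψ) (hbias φ)
  refine ⟨?_, fun h0 => ?_⟩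
  · rcases (Real.sqrt_nonneg (1 - g)).eq_or_lt with h0 | h0
    -- Division by zero in `EReal` is `0`, matching the stated convention.
    · rw [← h0, EReal.coe_zero, EReal.div_zero]
      exact EReal.coe_ennreal_nonneg _
    · have hpos : (0 : EReal) < ((√(1 - g) : ℝ) : EReal) := EReal.coe_pos.mpr h0
      refine le_trans ?_ hspread
      rw [EReal.div_le_iff_le_mul hpos (EReal.coe_ne_top _), ← EReal.coe_mul,
        mul_comm √(1 - g)]
      exact EReal.sub_le_of_le_add hbound
  · rw [h0, mul_zero, EReal.coe_zero, zero_add] at hbound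
    exact hbound

end MitigationProtocol

end ErrorMitigation

theorem mainTheorem6 {ι : Type*} [Fintype ι] [DecidableEq ι] {Q K : ℕ}
    (E : Fin Q → Fin K → QChannel ι) (P : MitigationProtocol ι Q K) :
    ((⨆ (ψ : QState ι) (φ : QState ι),
        ((traceDist ψ φ : EReal) - 2 * (P.maxBias E : EReal)) /
          ((√(1 - ∏ q, ∏ k, fidelity ((E q k).apply ψ) ((E q k).apply φ)) : ℝ) : EReal))
        ≤ (P.maxSpread : EReal) ∧
      ∀ ψ φ : QState ι,
        √(1 - ∏ q, ∏ k, fidelity ((E q k).apply ψ) ((E q k).apply φ)) = 0 →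
          (traceDist ψ φ : EReal) ≤ 2 * (P.maxBias E : EReal)) ∧
    ((⨆ (ψ : QState ι) (φ : QState ι),
        ((traceDist ψ φ : EReal) - 2 * (P.maxBias E : EReal)) /
          ((√(1 - ∏ q, ∏ k, subFidelity ((E q k).apply ψ) ((E q k).apply φ)) : ℝ) : EReal))
        ≤ (P.maxSpread : EReal) ∧
      ∀ ψ φ : QState ι,
        √(1 - ∏ q, ∏ k, subFidelity ((E q k).apply ψ) ((E q k).apply φ)) = 0 →
          (traceDist ψ φ : EReal) ≤ 2 * (P.maxBias E : EReal)) := by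
  have hsub (ψ φ : QState ι) :
      ∏ q, ∏ k, subFidelity ((E q k).apply ψ) ((E q k).apply φ) ≤
        ∏ q, ∏ k, fidelity ((E q k).apply ψ) ((E q k).apply φ) :=
    Finset.prod_le_prod
      (fun q _ => Finset.prod_nonneg fun k _ => subFidelity_nonneg _ _)
      (fun q _ => Finset.prod_le_prod (fun k _ => subFidelity_nonneg _ _)
        fun k _ => subFidelity_le_fidelity _ _)
  exact ⟨⟨iSup₂_le fun ψ φ => (P.quotient_le_maxSpread E ψ φ le_rfl).1,
      fun ψ φ => (P.quotient_le_maxSpread E ψ φ le_rfl).2⟩,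
    ⟨iSup₂_le fun ψ φ => (P.quotient_le_maxSpread E ψ φ (hsub ψ φ)).1,
      fun ψ φ => (P.quotient_le_maxSpread E ψ φ (hsub ψ φ)).2⟩⟩
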